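/- **Corollary 6.2 (universality of FlowAR).** *Notation.* For a token map $X\in\mathbb R^{h\times w\times d}$, identified with its matrix version in $\mathbb R^{hw\times d}$ whose rows are the tokens, let $\|X\|_\alpha=(\sum_{p,l}|X_{p,l}|^\alpha)^{1/\alpha}$ be the entrywise $\ell_\alpha$ norm, and for a function $F$ and a domain $\Omega$ let $\|F\|_{\alpha,\Omega}=(\int_\Omega\|F(X)\|_\alpha^\alpha\,dX)^{1/\alpha}$. A *linear sampling layer* $\Phi:\mathbb R^{h\times w\times d}\to\mathbb R^{h'\times w'\times d}$ is $X\mapsto\Phi X$ for a matrix $\Phi\in\mathbb R^{h'w'\times hw}$; it is a linear down-sampling layer by the factor $\rho$ when $h=\rho h'$, $w=\rho w'$. A *feed-forward layer* with $c$ hidden neurons applies $x\mapsto x+W_2\,\mathrm{ReLU}(W_1x+b_1)+b_2$ to every token, with $W_1\in\mathbb R^{c\times d}$, $b_1\in\mathbb R^c$, $W_2\in\mathbb R^{d\times c}$, $b_2\in\mathbb R^d$. An *attention layer* of head size $s$ is $X\mapsto D^{-1}AXW_VW_O$ with $A_{p,q}=\exp(X_{p}W_QW_K^\top X_{q}^\top)$,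 $D=\mathrm{diag}(A\mathbf 1)$, $W_Q,W_K,W_V\in\mathbb R^{d\times s}$, $W_O\in\mathbb R^{s\times d}$. A *one-layer transformer* with head size $s$ and $c$ hidden neurons is $X\mapsto \mathrm{FFN}_{m+l}\circ\cdots\circ\mathrm{FFN}_{m+1}\circ\mathrm{Attn}\circ\mathrm{FFN}_m\circ\cdots\circ\mathrm{FFN}_1(X+E)$ with one such attention layer, finitely many such feed-forward layers and a positional encoding $E$ (a fixed token map; $E=0$ means no positional encoding). For linear sampling layers $\Phi_{\mathrm{down},i}:\mathbb R^{h_{i-1}\times w_{i-1}\times d}\to\mathbb R^{h_i\times w_i\times d}$ and one-layer transformers $\tau_i$ on $\mathbb R^{h_i\times w_i\times d}$, $1\le i\le r$, the *FlowAR model* is $$\tau_{\mathsf{FlowAR}}=\tau_r\circ\Phi_{\mathrm{down},r}\circ\cdots\circ\tau_1\circ\Phi_{\mathrm{down},1}.$$ *Statement.* For every $K\ge0$ and $r\ge 0$ there is a constant $C>0$, depending only on $K$ and $r$, such that the following holds for all $d\ge1$, all positive sizes $h_0,w_0,\dots,h_r,w_r$, all $1\le\alpha<\infty$ and all $\varepsilon>0$.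 For $1\le i\le r$ let $f_i:\mathbb R^{h_i\times w_i\times d}\to\mathbb R^{h_i\times w_i\times d}$ and $g_i:\mathbb R^{h_{i-1}\times w_{i-1}\times d}\to\mathbb R^{h_i\times w_i\times d}$ be $K$-Lipschitz for $\|\cdot\|_\alpha$, let $\Phi_{\mathrm{down},i}$ be a linear sampling layer with $\|g_i(X)-\Phi_{\mathrm{down},i}(X)\|_\alpha\le\varepsilon$ for all $X$, and put $f_{\mathrm{word2img}}=f_r\circ g_r\circ\cdots\circ f_1\circ g_1$. Then: 1. If $\tau_1,\dots,\tau_r$ are one-layer transformers (of any one head size and number of hidden neurons) with $\|f_i(X)-\tau_i(X)\|_\alpha\le\varepsilon$ for all $X$ and $i$, then the FlowAR model built from the $\Phi_{\mathrm{down},i}$ and the $\tau_i$ satisfies $\|\tau_{\mathsf{FlowAR}}(X)-f_{\mathrm{word2img}}(X)\|_\alpha\le C\varepsilon$ for all $X\in\mathbb R^{h_0\times w_0\times d}$. 2. Without any assumption that the $f_i$ can be approximated by transformers: for every bounded measurable $\Omega\subset\mathbb R^{h_0\times w_0\times d}$ there are one-layer transformers $\tau_1,\dots,\tau_r$ of head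 size $1$ with $4$ hidden neurons such that the FlowAR model built from the $\Phi_{\mathrm{down},i}$ and the $\tau_i$ satisfies $$\|\tau_{\mathsf{FlowAR}}-f_{\mathrm{word2img}}\|_{\alpha,\Omega}\le C\,\varepsilon\,|\Omega|^{1/\alpha},$$ where $|\Omega|$ is the Lebesgue measure; moreover $\tau_i$ has no positional encoding whenever $f_i$ commutes with all permutations of the tokens. -/

import Mathlib

/-- Token maps `ℝ^{h × w × d}`. A spatial position `(a, b)` indexes a token in `ℝ^d`, so the same
object is also the matrix version in `ℝ^{hw × d}` whose rows are the tokens. -/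
abbrev TokenMap (h w d : ℕ) : Type := Fin h × Fin w → Fin d → ℝ

/-- The entrywise `ℓ_α` norm of a sequence of tokens. -/
noncomputable def entryNorm {ι : Type} [Fintype ι] {d : ℕ} (α : ℝ) (X : ι → Fin d → ℝ) : ℝ :=
  (∑ p, ∑ l, |X p l| ^ α) ^ (1 / α)

/-- `K`-Lipschitz maps between token maps, for the entrywise `ℓ_α` norm. -/
def IsLip {ι κ : Type} [Fintype ι] [Fintype κ] {d : ℕ} (α K : ℝ)
    (f : (ι → Fin d → ℝ) → (κ → Fin d → ℝ)) : Prop :=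
  ∀ X Y, entryNorm α (f X - f Y) ≤ K * entryNorm α (X - Y)

/-- The function norm `(∫_Ω ‖F(X)‖_α^α dX)^{1/α}` over a domain `Ω` of token maps, as an extended
nonnegative number (so that no integrability convention enters). -/
noncomputable def funNorm {h w : ℕ} {κ : Type} [Fintype κ] {d : ℕ} (α : ℝ)
    (Ω : Set (TokenMap h w d)) (F : TokenMap h w d → (κ → Fin d → ℝ)) : ENNReal :=
  (∫⁻ X in Ω, ENNReal.ofReal (entryNorm α (F X)) ^ α) ^ (1 / α)

/-- The linear sampling function `Y = Φ X`, acting on the spatial positions and on each channel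
separately. It is the linear down-sampling by a factor `ρ` when `h = ρ h'` and `w = ρ w'`. -/
def linearSample {h w h' w' d : ℕ} (Φ : Matrix (Fin h' × Fin w') (Fin h × Fin w) ℝ)
    (X : TokenMap h w d) : TokenMap h' w' d :=
  fun p l => ∑ q, Φ p q * X q l

/-- Weights of a feed-forward layer on tokens in `ℝ^d` with `c` hidden neurons. -/
structure FFNWeights (d c : ℕ) where
  W₁ : Matrix (Fin c) (Fin d) ℝ
  b₁ : Fin c → ℝ
  W₂ : Matrix (Fin d) (Fin c) ℝ
  b₂ : Fin d → ℝ

/-- The feed-forward layer `x ↦ x + W₂ ReLU(W₁ x + b₁) + b₂`, applied to every token. -/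
def FFNWeights.apply {d c : ℕ} (P : FFNWeights d c) {ι : Type} (X : ι → Fin d → ℝ) :
    ι → Fin d → ℝ :=
  fun p => X p + P.W₂.mulVec (fun j => max (P.W₁.mulVec (X p) j + P.b₁ j) 0) + P.b₂

/-- Weights of a single attention head of size `s` on tokens in `ℝ^d`. -/
structure AttnWeights (d s : ℕ) where
  WQ : Matrix (Fin d) (Fin s) ℝ
  WK : Matrix (Fin d) (Fin s) ℝ
  WV : Matrix (Fin d) (Fin s) ℝ
  WO : Matrix (Fin s) (Fin d) ℝ

/-- The attention matrix `A_{p,q} = exp(X_p WQ WKᵀ X_qᵀ)`. -/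
noncomputable def AttnWeights.matrix {d s : ℕ} (P : AttnWeights d s) {ι : Type}
    (X : ι → Fin d → ℝ) : Matrix ι ι ℝ :=
  fun p q => Real.exp (dotProduct (Matrix.vecMul (X p) P.WQ) (Matrix.vecMul (X q) P.WK))

/-- The attention layer `D⁻¹ A X WV WO` with `D = diag(A 1)`, written row by row. -/
noncomputable def AttnWeights.apply {d s : ℕ} (P : AttnWeights d s) {ι : Type} [Fintype ι]
    (X : ι → Fin d → ℝ) : ι → Fin d → ℝ :=
  fun p => Matrix.vecMul ((∑ q, P.matrix X p q)⁻¹ • ∑ q, P.matrix X p q • X q) (P.WV * P.WO)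

/-- A transformer with a single one-head self-attention layer of head size `s`, preceded and
followed by finitely many feed-forward layers with `c` hidden neurons. `pos` is the positional
encoding added to the input; `pos = 0` is a transformer without positional encoding. -/
structure OneLayerTransformer (ι : Type) (d s c : ℕ) where
  pos : ι → Fin d → ℝ
  pre : List (FFNWeights d c)
  att : AttnWeights d s
  post : List (FFNWeights d c)

/-- The function computed by the transformer; the lists of feed-forward layers are applied from
their first to their last element. -/
noncomputable def OneLayerTransformer.apply {ι : Type} [Fintype ι] {d s c : ℕ}
    (τ : OneLayerTransformer ι d s c) (X : ι → Fin d → ℝ) : ι → Fin d → ℝ :=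
  τ.post.foldl (fun Y P => P.apply Y)
    (τ.att.apply (τ.pre.foldl (fun Y P => P.apply Y) (X + τ.pos)))

/-- Maps that commute with every permutation of the tokens. -/
def TokenEquivariant {ι : Type} {d : ℕ} (f : (ι → Fin d → ℝ) → (ι → Fin d → ℝ)) : Prop :=
  ∀ (σ : Equiv.Perm ι) (X : ι → Fin d → ℝ), f (fun p => X (σ p)) = fun p => f X (σ p)

/-- The target function `f_n ∘ g_n ∘ ⋯ ∘ f_1 ∘ g_1`. The index is shifted by one: `g i` leads from
scale `i` to scale `i + 1`, and `f i` acts on scale `i + 1`. -/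
def word2img {d : ℕ} {h w : ℕ → ℕ}
    (f : ∀ i, TokenMap (h (i + 1)) (w (i + 1)) d → TokenMap (h (i + 1)) (w (i + 1)) d)
    (g : ∀ i, TokenMap (h i) (w i) d → TokenMap (h (i + 1)) (w (i + 1)) d) :
    ∀ n, TokenMap (h 0) (w 0) d → TokenMap (h n) (w n) d
  | 0 => id
  | n + 1 => fun X => f n (g n (word2img f g n X))

/-- The composed FlowAR model `τ_n ∘ Φ_n ∘ ⋯ ∘ τ_1 ∘ Φ_1`, with linear sampling layers `Φ_i` and
one-layer transformers `τ_i` (indices shifted by one as for the target function). -/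
noncomputable def flowAR {d s c : ℕ} {h w : ℕ → ℕ}
    (Φ : ∀ i, Matrix (Fin (h (i + 1)) × Fin (w (i + 1))) (Fin (h i) × Fin (w i)) ℝ)
    (τ : ∀ i, OneLayerTransformer (Fin (h (i + 1)) × Fin (w (i + 1))) d s c) :
    ∀ n, TokenMap (h 0) (w 0) d → TokenMap (h n) (w n) d :=
  word2img (fun i => (τ i).apply) (fun i => linearSample (Φ i))

/-! One stage turns an incoming error `e` into at most `ε + K * ε + K ^ 2 * e`
(`entryNorm_comp_sub_comp_le`). Iterating this proves the first claim, with a constant that sees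
only `K` and the number of stages.

For the second claim, `exists_transformer_approx` approximates a Lipschitz target on a box, off a
set of small measure. Feed-forward layers round all coordinates to a finite grid, failing only in
thin gaps between cells, and write an integer code of each grid token into one coordinate. Softmax
attention on that coordinate outputs a rational function of its base `x`. If the codes are pairwise
coprime and lie in `[L, 2L)`, two outputs agree identically in `x` only if the tokens agree and the
contexts agree as multisets; this comes down to a vanishing Wronskian. Hence some base separates all
the finitely many relevant cases (`IsCodeSet.exists_base`). The later layers are a lookup table from
attention outputs to values of the target. Where equivariance does not make the multiset sufficient,
a positional encoding does.

The approximation works for every finite measure, so the stages can be built one after another, each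
for the push-forward of Lebesgue measure on `Ω` through the stages before it
(`exists_flowAR_approx_off_small_set`). The bound on the outputs is fixed before the measure of the
exceptional set, so the contribution of that set to the integral can be made as small as desired. -/

/-! ### The entrywise norm and Lipschitz maps -/

section EntryNorm

variable {ι κ : Type} [Fintype ι] [Fintype κ] {d : ℕ} {α : ℝ}

lemma entryNorm_eq_sum_prod (X : ι → Fin d → ℝ) :
    entryNorm α X = (∑ i : ι × Fin d, |X i.1 i.2| ^ α) ^ (1 / α) := by
  rw [entryNorm, Fintype.sum_prod_type]

lemma entryNorm_nonneg (X : ι → Fin d → ℝ) : 0 ≤ entryNorm α X := by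
  unfold entryNorm; positivity

lemma entryNorm_zero (hα : 1 ≤ α) : entryNorm α (0 : ι → Fin d → ℝ) = 0 := by
  have h : α ≠ 0 := by positivity
  simp [entryNorm, Real.zero_rpow h, Real.zero_rpow (inv_ne_zero h)]

lemma entryNorm_add_le (hα : 1 ≤ α) (X Y : ι → Fin d → ℝ) :
    entryNorm α (X + Y) ≤ entryNorm α X + entryNorm α Y := by
  simp only [entryNorm_eq_sum_prod]
  exact Real.Lp_add_le Finset.univ (fun i : ι × Fin d => X i.1 i.2) (fun i => Y i.1 i.2) hα

lemma entryNorm_neg (X : ι → Fin d → ℝ) : entryNorm α (-X) = entryNorm α X := by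
  simp [entryNorm]

lemma entryNorm_sub_comm (X Y : ι → Fin d → ℝ) :
    entryNorm α (X - Y) = entryNorm α (Y - X) := by
  rw [← entryNorm_neg, neg_sub]

lemma entryNorm_sub_le (hα : 1 ≤ α) (X Y Z : ι → Fin d → ℝ) :
    entryNorm α (X - Z) ≤ entryNorm α (X - Y) + entryNorm α (Y - Z) := by
  simpa using entryNorm_add_le hα (X - Y) (Y - Z)

lemma abs_le_entryNorm (hα : 1 ≤ α) (X : ι → Fin d → ℝ) (p : ι) (l : Fin d) :
    |X p l| ≤ entryNorm α X := by
  have h0 : α ≠ 0 := by positivity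
  rw [entryNorm_eq_sum_prod]
  calc |X p l| = (|X p l| ^ α) ^ (1 / α) := by
        rw [← Real.rpow_mul (abs_nonneg _), mul_one_div_cancel h0, Real.rpow_one]
    _ ≤ _ := by
        refine Real.rpow_le_rpow (by positivity) ?_ (by positivity)
        exact Finset.single_le_sum (f := fun i : ι × Fin d => |X i.1 i.2| ^ α)
          (fun i _ => by positivity) (Finset.mem_univ (p, l))

lemma entryNorm_le_of_abs_le (hα : 1 ≤ α) {X : ι → Fin d → ℝ} {δ : ℝ} (hδ : 0 ≤ δ)
    (h : ∀ p l, |X p l| ≤ δ) :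
    entryNorm α X ≤ (Fintype.card (ι × Fin d) : ℝ) ^ (1 / α) * δ := by
  have h0 : α ≠ 0 := by positivity
  rw [entryNorm_eq_sum_prod]
  calc (∑ i : ι × Fin d, |X i.1 i.2| ^ α) ^ (1 / α)
      ≤ (∑ _i : ι × Fin d, δ ^ α) ^ (1 / α) := by
        refine Real.rpow_le_rpow (by positivity) ?_ (by positivity)
        exact Finset.sum_le_sum fun i _ =>
          Real.rpow_le_rpow (abs_nonneg _) (h i.1 i.2) (by positivity)
    _ = (Fintype.card (ι × Fin d) : ℝ) ^ (1 / α) * δ := by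
        rw [Finset.sum_const, nsmul_eq_mul, Finset.card_univ,
          Real.mul_rpow (by positivity) (by positivity), ← Real.rpow_mul hδ,
          mul_one_div_cancel h0, Real.rpow_one]

lemma IsLip.exists_bound {K : ℝ} (hK : 0 ≤ K) (hα : 1 ≤ α)
    {f : (ι → Fin d → ℝ) → (κ → Fin d → ℝ)} (hf : IsLip α K f) (R : ℝ) :
    ∃ M, 0 ≤ M ∧ ∀ X, (∀ p l, |X p l| ≤ R) → entryNorm α (f X) ≤ M := by
  refine ⟨K * ((Fintype.card (ι × Fin d) : ℝ) ^ (1 / α) * |R|) + entryNorm α (f 0),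
    add_nonneg (by positivity) (entryNorm_nonneg _), fun X hX => ?_⟩
  have h1 := entryNorm_add_le hα (f X - f 0) (f 0)
  have h2 := hf X 0
  have h3 := entryNorm_le_of_abs_le hα (abs_nonneg R) fun p l => (hX p l).trans (le_abs_self R)
  rw [sub_zero] at h2
  rw [sub_add_cancel] at h1
  nlinarith [mul_le_mul_of_nonneg_left h3 hK]

lemma IsLip.comp {μ : Type} [Fintype μ] {K L : ℝ} (hK : 0 ≤ K)
    {f : (ι → Fin d → ℝ) → (κ → Fin d → ℝ)} {g : (μ → Fin d → ℝ) → (ι → Fin d → ℝ)}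
    (hf : IsLip α K f) (hg : IsLip α L g) : IsLip α (K * L) fun X => f (g X) := fun X Y => by
  rw [mul_assoc]
  exact (hf _ _).trans (mul_le_mul_of_nonneg_left (hg X Y) hK)

end EntryNorm

/-! ### Token maps computed by feed-forward layers -/

section FeedForward

variable {d : ℕ}

/-- The action of a feed-forward layer on a single token. -/
noncomputable def FFNWeights.token {c : ℕ} (P : FFNWeights d c) (x : Fin d → ℝ) : Fin d → ℝ :=
  x + P.W₂.mulVec (fun j => max (P.W₁.mulVec x j + P.b₁ j) 0) + P.b₂

lemma foldl_ffn_apply {ι : Type} {c : ℕ} (L : List (FFNWeights d c)) (X : ι → Fin d → ℝ) :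
    L.foldl (fun Y P => P.apply Y) X = fun p => L.foldl (fun y P => P.token y) (X p) := by
  induction L generalizing X with
  | nil => rfl
  | cons P L ih => simp only [List.foldl_cons, ih]; rfl

/-- Token maps that are computed by finitely many feed-forward layers with four hidden neurons. -/
def FFNRealizable (φ : (Fin d → ℝ) → (Fin d → ℝ)) : Prop :=
  ∃ L : List (FFNWeights d 4), ∀ x, L.foldl (fun y P => P.token y) x = φ x

lemma FFNRealizable.id : FFNRealizable (fun x : Fin d → ℝ => x) := ⟨[], fun _ => rfl⟩

lemma FFNRealizable.comp {φ ψ : (Fin d → ℝ) → (Fin d → ℝ)} (hφ : FFNRealizable φ)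
    (hψ : FFNRealizable ψ) : FFNRealizable (fun x => φ (ψ x)) := by
  obtain ⟨L, hL⟩ := hφ
  obtain ⟨M, hM⟩ := hψ
  exact ⟨M ++ L, fun x => by rw [List.foldl_append, hM, hL]⟩

lemma FFNWeights.continuous_token {c : ℕ} (P : FFNWeights d c) : Continuous P.token := by
  unfold FFNWeights.token
  simp only [Matrix.mulVec, dotProduct]
  fun_prop

lemma FFNRealizable.continuous {φ : (Fin d → ℝ) → (Fin d → ℝ)} (hφ : FFNRealizable φ) :
    Continuous φ := by
  obtain ⟨L, hL⟩ := hφ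
  obtain rfl : (fun x => L.foldl (fun y P => P.token y) x) = φ := funext hL
  clear hL
  induction L with
  | nil => exact continuous_id
  | cons P L ih => exact ih.comp P.continuous_token

lemma ffnRealizable_layer (u : Fin 4 → Fin d → ℝ) (b : Fin 4 → ℝ) (y : Fin 4 → Fin d → ℝ)
    (z : Fin d → ℝ) :
    FFNRealizable (fun x : Fin d → ℝ => x + (∑ j, max (u j ⬝ᵥ x + b j) 0 • y j) + z) := by
  refine ⟨[⟨Matrix.of u, b, Matrix.of fun l j => y j l, z⟩], fun x => ?_⟩
  ext l
  simp [FFNWeights.token, Matrix.mulVec, dotProduct, mul_comm]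

/-- The piecewise linear function with `tent s δ s = 1` that vanishes at distance at least `δ`
from `s`. -/
noncomputable def tent (s δ t : ℝ) : ℝ :=
  δ⁻¹ * (max (t - s + δ) 0 - 2 * max (t - s) 0 + max (t - s - δ) 0)

lemma tent_self {s δ : ℝ} (hδ : 0 < δ) : tent s δ s = 1 := by
  simp [tent, hδ.le, hδ.ne']

lemma tent_eq_zero {s δ t : ℝ} (hδ : 0 < δ) (h : δ ≤ |t - s|) : tent s δ t = 0 := by
  rcases le_abs.1 h with h | h
  · rw [tent, max_eq_left (by linarith), max_eq_left (by linarith), max_eq_left (by linarith)]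
    ring
  · rw [tent, max_eq_right (by linarith), max_eq_right (by linarith), max_eq_right (by linarith)]
    ring

lemma ffnRealizable_tent (i : Fin d) (s δ : ℝ) (y : Fin d → ℝ) :
    FFNRealizable (fun x : Fin d → ℝ => x + tent s δ (x i) • y) := by
  -- A tent has three kinks, so it fits into one layer; the fourth neuron is idle.
  convert ffnRealizable_layer (fun _ => Pi.single i 1) ![-s + δ, -s, -s - δ, 0]
    ![δ⁻¹ • y, (-2 * δ⁻¹) • y, δ⁻¹ • y, 0] 0 using 2 with x
  ext l
  simp [Fin.sum_univ_four, tent]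
  ring_nf

lemma ffnRealizable_add_const (z : Fin d → ℝ) : FFNRealizable (fun x : Fin d → ℝ => x + z) := by
  simpa using ffnRealizable_layer 0 0 0 z

lemma ffnRealizable_add_linear (u y : Fin d → ℝ) :
    FFNRealizable (fun x : Fin d → ℝ => x + (u ⬝ᵥ x) • y) := by
  convert ffnRealizable_layer ![u, -u, 0, 0] 0 ![y, -y, 0, 0] 0 using 2 with x
  ext l
  simp only [Fin.sum_univ_four]
  have h : max (u ⬝ᵥ x) 0 - max (-(u ⬝ᵥ x)) 0 = u ⬝ᵥ x := max_zero_sub_max_neg_zero_eq_self _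
  simp
  linear_combination (-y l) * h

/-- Any shifts can be prescribed at finitely many values of one coordinate. -/
lemma exists_ffnRealizable_shift (i : Fin d) (S : Finset ℝ) (y : ℝ → Fin d → ℝ) :
    ∃ φ, FFNRealizable φ ∧ ∀ x : Fin d → ℝ, x i ∈ S → φ x = x + y (x i) := by
  -- `Y` bounds all the final values of coordinate `i`; first everything is moved above it
  obtain ⟨Y, hY⟩ : ∃ Y, ∀ s ∈ S, s + y s i ≤ Y := by
    obtain ⟨Y, hY⟩ := (S.image fun s => s + y s i).bddAbove
    exact ⟨Y, fun s hs => hY (by simpa using ⟨s, hs, rfl⟩)⟩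
  obtain ⟨m, hm⟩ := S.bddBelow
  have hm' : ∀ s ∈ S, m ≤ s := fun s hs => hm hs
  obtain ⟨δ, hδ, hδ1, hsep⟩ : ∃ δ > 0, δ ≤ 1 ∧ ∀ s ∈ S, ∀ t ∈ S, s ≠ t → δ ≤ |s - t| := by
    have h : ∀ᶠ δ in nhdsWithin (0 : ℝ) (Set.Ioi 0), ∀ s ∈ S, ∀ t ∈ S, s ≠ t → δ ≤ |s - t| := by
      simp only [Finset.eventually_all, Filter.eventually_imp_distrib_left]
      intro s _ t _ hst
      exact nhdsWithin_le_nhds (eventually_le_nhds (abs_pos.2 (sub_ne_zero.2 hst)))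
    obtain ⟨δ, ⟨h0, h1⟩, h2⟩ :=
      ((eventually_mem_nhdsWithin.and
        (nhdsWithin_le_nhds (eventually_le_nhds one_pos))).and h).exists
    exact ⟨δ, h0, h1, h2⟩
  -- Lifted values satisfy `s + B ≥ Y + 1`, while treated tokens stay at or below `Y`. Since `δ ≤
  -- 1`, a tent at `s + B` misses all treated tokens, and by `hsep` also the other lifted ones.
  set B : ℝ := Y - m + 1 with hB
  have key : ∀ T ⊆ S, ∃ φ, FFNRealizable φ ∧ ∀ x : Fin d → ℝ, x i ∈ S →
      φ x = if x i ∈ T then x + y (x i) else x + Pi.single i B := by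
    intro T
    induction T using Finset.induction_on with
    | empty =>
      intro _
      exact ⟨_, ffnRealizable_add_const (Pi.single i B), by simp⟩
    | insert s T hsT ih =>
      intro hT
      obtain ⟨φ, hφ, h⟩ := ih ((Finset.subset_insert _ _).trans hT)
      have hs : s ∈ S := hT (Finset.mem_insert_self _ _)
      refine ⟨_, (ffnRealizable_tent i (s + B) δ (y s - Pi.single i B)).comp hφ, ?_⟩
      intro x hx
      simp only [h x hx, Finset.mem_insert]
      by_cases hxT : x i ∈ T
      · have hne : x i ≠ s := fun e => hsT (e ▸ hxT)
        rw [if_pos hxT, if_pos (Or.inr hxT), tent_eq_zero hδ, zero_smul, add_zero]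
        rw [le_abs]; right
        have := hY _ hx
        have := hm' s hs
        simp only [Pi.add_apply]
        linarith
      · by_cases hxs : x i = s
        · rw [if_neg hxT, if_pos (Or.inl hxs)]
          have : (x + Pi.single i B : Fin d → ℝ) i = s + B := by simp [hxs]
          rw [this, tent_self hδ, hxs]
          simp
        · rw [if_neg hxT, if_neg (by tauto), tent_eq_zero hδ, zero_smul, add_zero]
          have := hsep _ hx _ hs hxs
          simpa using this
  obtain ⟨φ, hφ, h⟩ := key S subset_rfl
  exact ⟨φ, hφ, fun x hx => by rw [h x hx, if_pos hx]⟩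

/-- Scalar functions that feed-forward layers can apply to any single coordinate. -/
def CoordRealizable (d : ℕ) (ψ : ℝ → ℝ) : Prop :=
  ∀ i : Fin d, FFNRealizable (fun x => Function.update x i (ψ (x i)))

lemma CoordRealizable.id : CoordRealizable d (fun t => t) := fun i => by
  simpa using FFNRealizable.id

lemma CoordRealizable.comp {ψ χ : ℝ → ℝ} (hψ : CoordRealizable d ψ) (hχ : CoordRealizable d χ) :
    CoordRealizable d (fun t => ψ (χ t)) := fun i => by
  simpa using (hψ i).comp (hχ i)

lemma CoordRealizable.map {ψ : ℝ → ℝ} (hψ : CoordRealizable d ψ) :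
    FFNRealizable (fun (x : Fin d → ℝ) l => ψ (x l)) := by
  have key : ∀ S : Finset (Fin d),
      FFNRealizable (fun (x : Fin d → ℝ) l => if l ∈ S then ψ (x l) else x l) := by
    intro S
    induction S using Finset.induction_on with
    | empty => simpa using FFNRealizable.id
    | insert i S hi ih =>
      convert (hψ i).comp ih using 2 with x
      ext l
      by_cases hl : l = i
      · subst hl; simp [hi]
      · simp [hl]
  simpa using key Finset.univ

lemma coordRealizable_relu (a b c : Fin 4 → ℝ) :
    CoordRealizable d (fun t => t + ∑ j, c j * max (a j * t + b j) 0) := fun i => by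
  convert ffnRealizable_layer (fun j => Pi.single i (a j)) b (fun j => Pi.single i (c j)) 0
    using 2 with x
  ext l
  by_cases hl : l = i
  · subst hl; simp [mul_comm]
  · simp [hl]

/-- The layer which is constant on `[a, b]` and the identity outside `(a, c)`. -/
lemma exists_coordRealizable_collapse (d : ℕ) {a b c : ℝ} (hab : a ≤ b) (hbc : b < c) :
    ∃ ψ, CoordRealizable d ψ ∧ (∀ t ≤ a, ψ t = t) ∧ (∀ t, a ≤ t → t ≤ b → ψ t = a) ∧
      ∀ t, c ≤ t → ψ t = t := by
  have hcb : c - b ≠ 0 := (sub_pos.2 hbc).ne'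
  -- The slope is `0` on `[a, b]`, then `(c - a) / (c - b)` so as to climb from `a` back to the
  -- diagonal at `c`, then `1`.
  refine ⟨_, coordRealizable_relu 1 ![-a, -b, -c, 0]
    ![-1, (c - a) / (c - b), 1 - (c - a) / (c - b), 0], fun t ht => ?_, fun t ht ht' => ?_,
    fun t ht => ?_⟩ <;> simp [Fin.sum_univ_four]
  · rw [max_eq_right (by linarith), max_eq_right (by linarith), max_eq_right (by linarith)]
    ring
  · rw [max_eq_left (by linarith), max_eq_right (by linarith), max_eq_right (by linarith)]
    ring
  · rw [max_eq_left (by linarith), max_eq_left (by linarith), max_eq_left (by linarith)]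
    field_simp
    ring

/-- Cells are collapsed from left to right: each collapse fixes everything up to the start of its
own cell, so earlier results survive. Nothing is claimed in the gaps of width `γ`, where a
continuous map has to climb to the next cell. -/
lemma exists_coordRealizable_quantizer (d : ℕ) (A : ℝ) {δ γ : ℝ} (hγ : 0 < γ) (hγδ : γ < δ)
    (N : ℕ) :
    ∃ ψ, CoordRealizable d ψ ∧ (∀ t, A + N * δ ≤ t → ψ t = t) ∧
      ∀ j < N, ∀ t, A + j * δ ≤ t → t ≤ A + j * δ + δ - γ → ψ t = A + j * δ := by
  induction N with
  | zero => exact ⟨_, CoordRealizable.id, fun _ _ => rfl, by simp⟩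
  | succ N ih =>
    obtain ⟨ψ, hψ, h1, h2⟩ := ih
    obtain ⟨χ, hχ, g1, g2, g3⟩ := exists_coordRealizable_collapse d
      (a := A + N * δ) (b := A + N * δ + δ - γ) (c := A + N * δ + δ) (by linarith) (by linarith)
    refine ⟨_, hχ.comp hψ, fun t ht => ?_, fun j hj t ht ht' => ?_⟩
    · push_cast at ht
      rw [h1 t (by linarith), g3 t (by linarith)]
    · rcases Nat.lt_succ_iff_lt_or_eq.1 hj with hj | rfl
      · rw [h2 j hj t ht ht', g1]
        have : (j : ℝ) ≤ N := by exact_mod_cast hj.le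
        nlinarith
      · rw [h1 t ht, g2 t ht ht']

lemma exists_coordRealizable_clamp (d : ℕ) {M : ℝ} (hM : 0 ≤ M) :
    ∃ ψ, CoordRealizable d ψ ∧ (∀ t, |t| ≤ M → ψ t = t) ∧ ∀ t, |ψ t| ≤ M := by
  refine ⟨_, coordRealizable_relu ![1, -1, 0, 0] ![-M, -M, 0, 0] ![-1, 1, 0, 0],
    fun t ht => ?_, fun t => ?_⟩ <;> simp [Fin.sum_univ_four]
  · rw [abs_le] at ht
    rw [max_eq_right (by linarith), max_eq_right (by linarith)]
    ring
  · rw [abs_le]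
    constructor <;> rcases max_cases (t + -M) 0 with h | h <;>
      rcases max_cases (-t + -M) 0 with h' | h' <;> linarith

end FeedForward

/-! ### Softmax attention separates contexts of coprime codes -/

section ContextMap

open Polynomial

/-- Polynomials in characteristic zero with vanishing Wronskian are proportional; here the factor
is fixed by the values at one point. -/
lemma eq_of_derivative_mul_eq {G H : ℝ[X]} (h : derivative G * H = G * derivative H)
    {t : ℝ} (ht : G.eval t = H.eval t) (h0 : G.eval t ≠ 0) : G = H := by
  have hG : G ≠ 0 := by rintro rfl; simp at h0
  obtain ⟨G₁, H₁, hc, hG₁, hH₁⟩ :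
      ∃ G₁ H₁ : ℝ[X], IsCoprime G₁ H₁ ∧ G = gcd G H * G₁ ∧ H = gcd G H * H₁ := by
    have hgcd : gcd G H ≠ 0 := fun e => hG ((gcd_eq_zero_iff _ _).1 e).1
    exact ⟨_, _, isCoprime_div_gcd_div_gcd_of_gcd_ne_zero hgcd,
      (EuclideanDomain.mul_div_cancel' hgcd (gcd_dvd_left _ _)).symm,
      (EuclideanDomain.mul_div_cancel' hgcd (gcd_dvd_right _ _)).symm⟩
  set g := gcd G H
  have hg : g ≠ 0 := by intro e; rw [e, zero_mul] at hG₁; exact hG hG₁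
  have hw : wronskian G₁ H₁ = 0 := by
    -- A common factor `g` multiplies the Wronskian by `g ^ 2`. For the coprime cofactors, a zero
    -- Wronskian forces both derivatives to vanish.
    have : g ^ 2 * wronskian G₁ H₁ = 0 := by
      have h' := h
      rw [hG₁, hH₁] at h'
      simp only [derivative_mul] at h'
      rw [wronskian]
      linear_combination -h'
    simpa [hg] using this
  obtain ⟨h1, h2⟩ := hc.wronskian_eq_zero_iff.1 hw
  rw [eq_C_of_derivative_eq_zero h1] at hG₁
  rw [eq_C_of_derivative_eq_zero h2] at hH₁
  rw [hG₁, hH₁] at ht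
  rw [hG₁] at h0
  simp only [eval_mul, eval_C] at ht h0
  have := mul_left_cancel₀ (left_ne_zero_of_mul h0) ht
  rw [hG₁, hH₁, this]

variable {ι : Type} [Fintype ι]

/-- The coefficient at `n` counts the indices with exponent `n`, so the fibres of `v` and `w` have
equal size. -/
lemma exists_perm_of_sum_X_pow_eq {v w : ι → ℕ} (h : ∑ p, (X : ℝ[X]) ^ v p = ∑ p, X ^ w p) :
    ∃ σ : Equiv.Perm ι, ∀ p, w p = v (σ p) := by
  classical
  have hcard : ∀ n, Nonempty ({p // w p = n} ≃ {p // v p = n}) := by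
    intro n
    rw [← Fintype.card_eq, Fintype.card_subtype, Fintype.card_subtype]
    have := congrArg (fun P => coeff P n) h
    simp only [finsetSum_coeff, coeff_X_pow, Finset.sum_boole, eq_comm (a := n)] at this
    exact_mod_cast this.symm
  exact ⟨Equiv.ofFiberEquiv fun n => (hcard n).some, fun p => (Equiv.ofFiberEquiv_map _ p).symm⟩

/-- The output of softmax attention at position `p`, for scalar tokens `v` and base `x`. -/
noncomputable def attnValue (x : ℝ) (v : ι → ℕ) (p : ι) : ℝ :=
  (∑ q, x ^ (v p * v q))⁻¹ * ∑ q, x ^ (v p * v q) * v q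

/-- The polynomial that vanishes at bases for which two attention outputs coincide. -/
noncomputable def clashPoly (v w : ι → ℕ) (p p' : ι) : ℝ[X] :=
  ∑ q, ∑ q', C ((v q : ℝ) - w q') * X ^ (v p * v q + w p' * w q')

lemma eval_clashPoly_eq_zero {x : ℝ} (hx : 0 < x) {v w : ι → ℕ} {p p' : ι}
    (h : attnValue x v p = attnValue x w p') : (clashPoly v w p p').eval x = 0 := by
  have hs : ∀ (v : ι → ℕ) (p : ι), 0 < ∑ q, x ^ (v p * v q) := fun v p =>
    Finset.sum_pos (fun q _ => by positivity) ⟨p, Finset.mem_univ _⟩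
  have h1 := (hs v p).ne'
  have h2 := (hs w p').ne'
  simp only [attnValue] at h
  rw [inv_mul_eq_iff_eq_mul₀ h1, mul_comm, mul_assoc, eq_comm, inv_mul_eq_iff_eq_mul₀ h2] at h
  simp only [clashPoly, eval_finsetSum, eval_mul, eval_C, eval_pow, eval_X]
  have : ∀ q q', ((v q : ℝ) - w q') * x ^ (v p * v q + w p' * w q') =
      (x ^ (v p * v q) * v q) * x ^ (w p' * w q') -
        x ^ (v p * v q) * (x ^ (w p' * w q') * w q') := fun q q' => by ring
  simp only [this, Finset.sum_sub_distrib, ← Finset.mul_sum, ← Finset.sum_mul]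
  linear_combination -h

/-- A finite set of codes for which attention distinguishes contexts. -/
structure IsCodeSet (S : Set ℕ) (L : ℕ) : Prop where
  pos : 0 < L
  le : ∀ a ∈ S, L ≤ a
  lt : ∀ a ∈ S, a < 2 * L
  coprime : S.Pairwise Nat.Coprime

/-- The equation reads `a (b - a) = a' (a' - b')`. By coprimality `a'` divides `b - a`, whose
absolute value is below `L ≤ a'`. This isolates one monomial of `clashPoly`. -/
lemma IsCodeSet.eq_of_add_eq {S : Set ℕ} {L : ℕ} (hS : IsCodeSet S L) {a a' b b' : ℕ}
    (ha : a ∈ S) (ha' : a' ∈ S) (hb : b ∈ S) (hne : a ≠ a')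
    (h : a * b + a' * b' = a * a + a' * a') : b = a ∧ b' = a' := by
  have hL := hS.pos
  have h1 := hS.le a ha
  have h2 := hS.le a' ha'
  have h3 := hS.le b hb
  have h4 := hS.lt a ha
  have h5 := hS.lt b hb
  have hco : IsCoprime (a' : ℤ) a := Nat.isCoprime_iff_coprime.2 (hS.coprime ha' ha hne.symm)
  have hz : (a : ℤ) * (b - a) = a' * (a' - b') := by
    have : (a : ℤ) * b + a' * b' = a * a + a' * a' := by exact_mod_cast h
    linear_combination this
  have hdvd : (a' : ℤ) ∣ b - a := hco.dvd_of_dvd_mul_left ⟨_, hz⟩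
  have h0 : (b : ℤ) - a = 0 := Int.eq_zero_of_abs_lt_dvd hdvd (by rw [abs_lt]; omega)
  have hba : b = a := by omega
  subst hba
  refine ⟨rfl, ?_⟩
  have : a' * b' = a' * a' := by omega
  exact Nat.eq_of_mul_eq_mul_left (by omega) this

/-- With `F = (2m)!`, a prime dividing both `1 + i F` and `1 + j F` divides `(i - j) F`, hence `F`
because `|i - j| ≤ 2m`, and therefore `1`. -/
lemma exists_isCodeSet (m : ℕ) : ∃ (S : Finset ℕ) (L : ℕ), IsCodeSet S L ∧ S.card = m := by
  have hF : 0 < (2 * m).factorial := Nat.factorial_pos _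
  set F := (2 * m).factorial with hFdef
  have hinj : Function.Injective fun j => 1 + j * F := fun i j h => by
    have : i * F = j * F := by simpa using h
    exact Nat.eq_of_mul_eq_mul_right hF this
  refine ⟨(Finset.Ico m (2 * m)).image fun j => 1 + j * F, 1 + m * F, ⟨by positivity, ?_, ?_, ?_⟩,
    ?_⟩
  · simp only [Finset.coe_image, Set.forall_mem_image, Finset.coe_Ico, Set.mem_Ico]
    intro j hj
    gcongr
    exact hj.1
  · simp only [Finset.coe_image, Set.forall_mem_image, Finset.coe_Ico, Set.mem_Ico]
    intro j hj
    have : j * F ≤ 2 * m * F := Nat.mul_le_mul_right _ hj.2.le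
    nlinarith
  · simp only [Finset.coe_image]
    rintro _ ⟨i, hi, rfl⟩ _ ⟨j, hj, rfl⟩ hne
    simp only [Finset.coe_Ico, Set.mem_Ico] at hi hj
    refine Nat.Coprime.symm ?_
    refine Nat.coprime_of_dvd fun k hk h1 h2 => ?_
    simp only at h1 h2
    have hz : (k : ℤ) ∣ (i - j) * F := by
      have h1' : (k : ℤ) ∣ 1 + j * F := by exact_mod_cast h1
      have h2' : (k : ℤ) ∣ 1 + i * F := by exact_mod_cast h2
      have := dvd_sub h2' h1'
      ring_nf at this ⊢
      exact this
    have hkF : k ∣ F := by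
      rcases Int.Prime.dvd_mul' hk hz with h | h
      · have hij : i ≠ j := fun e => hne (by rw [e])
        have hkm : k ≤ 2 * m := by
          have := Int.le_of_dvd (abs_pos.2 (sub_ne_zero.2 (Nat.cast_injective.ne hij)))
            ((dvd_abs _ _).2 h)
          have h3 : |(i : ℤ) - j| ≤ 2 * m := by rw [abs_le]; omega
          omega
        exact Nat.dvd_factorial hk.pos hkm
      · exact_mod_cast h
    exact hk.one_lt.ne' (Nat.dvd_one.1 ((Nat.dvd_add_left (hkF.mul_left j)).1 h1))
  · rw [Finset.card_image_of_injective _ hinj, Nat.card_Ico]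
    omega

lemma X_mul_derivative_X_pow (n : ℕ) : (X : ℝ[X]) * derivative (X ^ n) = C (n : ℝ) * X ^ n := by
  cases n with
  | zero => simp
  | succ n => rw [derivative_X_pow, Nat.add_sub_cancel, pow_succ]; ring

lemma IsCodeSet.of_clashPoly_eq_zero {S : Set ℕ} {L : ℕ} (hS : IsCodeSet S L) {v w : ι → ℕ}
    (hv : ∀ q, v q ∈ S) (hw : ∀ q, w q ∈ S) {p p' : ι} (h : clashPoly v w p p' = 0) :
    v p = w p' ∧ ∃ σ : Equiv.Perm ι, ∀ q, w q = v (σ q) := by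
  classical
  have hL := hS.pos
  have hap : v p = w p' := by
    by_contra hne
    -- At this exponent only pairs with `v q = v p` and `w q' = w p'` contribute, all with the same
    -- factor `v p - w p'`, so nothing cancels.
    have hc := congrArg (fun P => coeff P (v p * v p + w p' * w p')) h
    simp only [clashPoly, finsetSum_coeff, coeff_C_mul, coeff_X_pow, coeff_zero] at hc
    have hterm : ∀ q q', ((v q : ℝ) - w q') *
        (if v p * v p + w p' * w p' = v p * v q + w p' * w q' then 1 else 0) =
        ((v p : ℝ) - w p') * if v q = v p ∧ w q' = w p' then 1 else 0 := by
      intro q q'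
      by_cases hq : v q = v p ∧ w q' = w p'
      · simp [hq.1, hq.2]
      · rw [if_neg hq, if_neg, mul_zero, mul_zero]
        exact fun e => hq (hS.eq_of_add_eq (hv p) (hw p') (hv q) hne e.symm)
    simp only [hterm, ← Finset.mul_sum] at hc
    have hne' : (v p : ℝ) - w p' ≠ 0 := sub_ne_zero.2 (Nat.cast_injective.ne hne)
    refine (mul_ne_zero hne' (ne_of_gt ?_)) hc
    refine Finset.sum_pos' (fun _ _ => Finset.sum_nonneg fun _ _ => by positivity)
      ⟨p, Finset.mem_univ _, ?_⟩
    refine Finset.sum_pos' (fun _ _ => by positivity) ⟨p', Finset.mem_univ _, by simp⟩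
  refine ⟨hap, exists_perm_of_sum_X_pow_eq ?_⟩
  have ha : 0 < v p := hL.trans_le (hS.le _ (hv p))
  set G : ℝ[X] := ∑ q, X ^ v q with hG
  set H : ℝ[X] := ∑ q, X ^ w q with hH
  have hX : ∀ u : ι → ℕ, X * derivative (∑ q, (X : ℝ[X]) ^ u q) =
      ∑ q, C (u q : ℝ) * X ^ u q := fun u => by
    rw [derivative_sum, Finset.mul_sum]
    exact Finset.sum_congr rfl fun q _ => X_mul_derivative_X_pow _
  -- With `v p = w p'`, every exponent is a multiple of this common code. Dividing it out leaves `X`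
  -- times the Wronskian of the generating polynomials, up to sign.
  have hexp : clashPoly v w p p' = expand ℝ (v p) (X * (derivative G * H - G * derivative H)) := by
    have : X * (derivative G * H - G * derivative H) =
        ∑ q, ∑ q', C ((v q : ℝ) - w q') * X ^ (v q + w q') := by
      have h1 : ∀ q q', C ((v q : ℝ) - w q') * X ^ (v q + w q') =
          (C (v q : ℝ) * X ^ v q) * X ^ w q' - X ^ v q * (C (w q' : ℝ) * X ^ w q') :=
        fun q q' => by rw [C_sub]; ring
      simp only [h1, Finset.sum_sub_distrib, ← Finset.mul_sum, ← Finset.sum_mul, ← hX]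
      ring
    rw [this]
    simp only [clashPoly, map_sum, map_mul, expand_C, map_pow, expand_X, ← hap, ← pow_mul,
      ← mul_add]
  rw [hexp, expand_eq_zero ha] at h
  have h' := (mul_eq_zero.1 h).resolve_left X_ne_zero
  have hne : (Fintype.card ι : ℝ) ≠ 0 := by
    have : Nonempty ι := ⟨p⟩
    exact_mod_cast Fintype.card_ne_zero
  -- At `1` both generating polynomials equal the number of tokens.
  exact eq_of_derivative_mul_eq (t := 1) (sub_eq_zero.1 h') (by simp [hG, hH, eval_finsetSum])
    (by simpa [hG, eval_finsetSum] using hne)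

/-- For a suitable base, the attention output at a position determines the token there and the
whole context up to a permutation. -/
lemma IsCodeSet.exists_base {S : Finset ℕ} {L : ℕ} (hS : IsCodeSet S L) (ι : Type) [Fintype ι] :
    ∃ x : ℝ, 0 < x ∧ ∀ v w : ι → ℕ, (∀ q, v q ∈ S) → (∀ q, w q ∈ S) → ∀ p p',
      attnValue x v p = attnValue x w p' →
        v p = w p' ∧ ∃ σ : Equiv.Perm ι, ∀ q, w q = v (σ q) := by
  classical
  let T : Finset ((ι → ℕ) × (ι → ℕ) × ι × ι) :=
    (Fintype.piFinset fun _ => S) ×ˢ (Fintype.piFinset fun _ => S) ×ˢ Finset.univ ×ˢ Finset.univ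
  let Z : Finset ℝ := T.biUnion fun t => (clashPoly t.1 t.2.1 t.2.2.1 t.2.2.2).roots.toFinset
  -- Finitely many nonzero polynomials have finitely many roots altogether.
  obtain ⟨x, hx, hxZ⟩ := (Set.Ioi_infinite (0 : ℝ)).exists_notMem_finset Z
  refine ⟨x, hx, fun v w hv hw p p' h => hS.of_clashPoly_eq_zero hv hw ?_⟩
  by_contra hne
  refine hxZ (Finset.mem_biUnion.2 ⟨(v, w, p, p'), ?_, ?_⟩)
  · simp [T, hv, hw]
  · rw [Multiset.mem_toFinset, mem_roots hne]
    exact eval_clashPoly_eq_zero hx h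

end ContextMap

/-! ### Approximation of one Lipschitz map by one transformer -/

section Transformer

open MeasureTheory

variable {ι : Type} [Fintype ι] {d : ℕ}

/-- The attention layer that reads and writes only coordinate `i`, with base `exp β`. -/
noncomputable def scalarAttn (i : Fin d) (β : ℝ) : AttnWeights d 1 where
  WQ := Matrix.of fun l _ => if l = i then β else 0
  WK := Matrix.of fun l _ => if l = i then 1 else 0
  WV := Matrix.of fun l _ => if l = i then 1 else 0
  WO := Matrix.of fun _ l => if l = i then 1 else 0

lemma scalarAttn_apply (i : Fin d) {x : ℝ} (hx : 0 < x) {X : ι → Fin d → ℝ} {v : ι → ℕ}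
    (hX : ∀ p, X p i = v p) (p : ι) :
    (scalarAttn i (Real.log x)).apply X p = Pi.single i (attnValue x v p) := by
  have hm : ∀ q, (scalarAttn i (Real.log x)).matrix X p q = x ^ (v p * v q) := by
    intro q
    rw [← Real.exp_log hx, ← Real.exp_nat_mul, Real.exp_log hx]
    simp [AttnWeights.matrix, scalarAttn, Matrix.vecMul, dotProduct, hX]
    ring
  ext l
  simp only [AttnWeights.apply, hm, attnValue]
  simp [scalarAttn, Matrix.vecMul, dotProduct, Matrix.mul_apply, hX, Pi.single_apply]

lemma AttnWeights.continuous_apply {s : ℕ} (P : AttnWeights d s) :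
    Continuous fun X : ι → Fin d → ℝ => P.apply X := by
  refine continuous_pi fun p => ?_
  have hc : ∀ q, Continuous fun X : ι → Fin d → ℝ => P.matrix X p q := fun q => by
    simp only [AttnWeights.matrix, Matrix.vecMul, dotProduct]
    fun_prop
  have h0 : ∀ X : ι → Fin d → ℝ, ∑ q, P.matrix X p q ≠ 0 := fun X =>
    (Finset.sum_pos (fun q _ => Real.exp_pos _) ⟨p, Finset.mem_univ _⟩).ne'
  have h1 : Continuous fun X : ι → Fin d → ℝ => (∑ q, P.matrix X p q)⁻¹ :=
    (continuous_finsetSum _ fun q _ => hc q).inv₀ h0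
  unfold AttnWeights.apply
  fun_prop

lemma exists_transformer_apply_eq {φ χ : (Fin d → ℝ) → (Fin d → ℝ)} (hφ : FFNRealizable φ)
    (hχ : FFNRealizable χ) (A : AttnWeights d 1) (E : ι → Fin d → ℝ) :
    ∃ τ : OneLayerTransformer ι d 1 4, τ.pos = E ∧ Continuous τ.apply ∧
      ∀ X, τ.apply X = fun p => χ (A.apply (fun q => φ (X q + E q)) p) := by
  have hφc := hφ.continuous
  have hχc := hχ.continuous
  obtain ⟨L, hL⟩ := hφ
  obtain ⟨M, hM⟩ := hχ
  have key : ∀ X, (⟨E, L, A, M⟩ : OneLayerTransformer ι d 1 4).apply X =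
      fun p => χ (A.apply (fun q => φ (X q + E q)) p) := by
    intro X
    simp only [OneLayerTransformer.apply, foldl_ffn_apply, hL, hM, Pi.add_apply]
  refine ⟨⟨E, L, A, M⟩, rfl, ?_, key⟩
  rw [funext key]
  have := A.continuous_apply (ι := ι)
  refine continuous_pi fun p => hχc.comp ?_
  exact (continuous_apply p).comp (this.comp (by fun_prop))

/-- Some linear functional is nonzero on all the finitely many differences of distinct points. -/
lemma exists_dotProduct_injOn (V : Finset (Fin d → ℝ)) :
    ∃ u : Fin d → ℝ, Set.InjOn (fun x => u ⬝ᵥ x) V := by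
  classical
  obtain ⟨F, hF⟩ := Module.exists_dual_forall_apply_ne_zero (K := ℝ)
    (fun t : V.offDiag => t.1.1 - t.1.2)
    (fun t => sub_ne_zero.2 (Finset.mem_offDiag.1 t.2).2.2)
  have hFu : ∀ x, (fun l => F (Pi.single l 1)) ⬝ᵥ x = F x := fun x => by
    conv_rhs => rw [← Finset.univ_sum_single x]
    rw [map_sum]
    refine Finset.sum_congr rfl fun l _ => ?_
    rw [show (Pi.single l (x l) : Fin d → ℝ) = x l • Pi.single l 1 by
      rw [← Pi.single_smul, smul_eq_mul, mul_one], map_smul, smul_eq_mul, mul_comm]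
  refine ⟨fun l => F (Pi.single l 1), fun x hx y hy h => ?_⟩
  by_contra hne
  simp only [hFu] at h
  exact hF ⟨(x, y), Finset.mem_offDiag.2 ⟨hx, hy, hne⟩⟩ (by rw [map_sub, h, sub_self])

/-- Feed-forward layers can write injective codes of finitely many tokens to a coordinate. -/
lemma exists_ffnRealizable_encoder (i : Fin d) (V : Finset (Fin d → ℝ)) :
    ∃ (S : Finset ℕ) (L : ℕ) (c : (Fin d → ℝ) → ℕ) (φ : (Fin d → ℝ) → (Fin d → ℝ)),
      IsCodeSet S L ∧ (∀ x ∈ V, c x ∈ S) ∧ Set.InjOn c V ∧ FFNRealizable φ ∧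
        ∀ x ∈ V, φ x i = c x := by
  classical
  obtain ⟨S, L, hS, hcard⟩ := exists_isCodeSet V.card
  obtain ⟨u, hu⟩ := exists_dotProduct_injOn V
  let e := Finset.equivOfCardEq hcard.symm
  let c : (Fin d → ℝ) → ℕ := fun x => if h : x ∈ V then e ⟨x, h⟩ else 0
  have hc : ∀ x (h : x ∈ V), c x = e ⟨x, h⟩ := fun x h => dif_pos h
  let inv : ℝ → (Fin d → ℝ) := Function.invFunOn (fun x => u ⬝ᵥ x) V
  have hinv : ∀ x ∈ V, inv (u ⬝ᵥ x) = x := fun x hx => hu.leftInvOn_invFunOn hx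
  obtain ⟨φ, hφ, h⟩ := exists_ffnRealizable_shift i (V.image fun x => u ⬝ᵥ x)
    fun t => Pi.single i (c (inv t) - t)
  -- The linear layer makes coordinate `i` equal to `u ⬝ᵥ x`, which identifies the token; the shift
  -- then replaces this number by the code.
  refine ⟨S, L, c, _, hS, fun x hx => ?_, fun x hx y hy hxy => ?_,
    hφ.comp (ffnRealizable_add_linear (u - Pi.single i 1) (Pi.single i 1)), fun x hx => ?_⟩
  · rw [hc x hx]; exact (e _).2
  · rw [hc x hx, hc y hy] at hxy
    simpa using e.injective (Subtype.ext hxy)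
  · have hi : (x + ((u - Pi.single i 1) ⬝ᵥ x) • Pi.single i 1 : Fin d → ℝ) i = u ⬝ᵥ x := by
      simp [sub_dotProduct]
    rw [h _ (by rw [hi]; exact Finset.mem_image_of_mem _ hx), Pi.add_apply, hi, hinv x hx]
    simp

/-- The left end point of the cell of width `δ` that contains `t`, with cells starting at `A`. -/
noncomputable def cellStart (A δ t : ℝ) : ℝ := A + ⌊(t - A) / δ⌋₊ * δ

lemma cellStart_le {A δ t : ℝ} (hδ : 0 < δ) (ht : A ≤ t) : cellStart A δ t ≤ t := by
  have := Nat.floor_le (div_nonneg (sub_nonneg.2 ht) hδ.le)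
  rw [le_div_iff₀ hδ] at this
  unfold cellStart
  linarith

lemma lt_cellStart_add {A δ : ℝ} (hδ : 0 < δ) (t : ℝ) : t < cellStart A δ t + δ := by
  have := Nat.lt_floor_add_one ((t - A) / δ)
  rw [div_lt_iff₀ hδ] at this
  unfold cellStart
  linarith

lemma measurable_cellStart (A δ : ℝ) : Measurable (cellStart A δ) := by
  unfold cellStart
  have : Measurable fun t : ℝ => ⌊(t - A) / δ⌋₊ := Nat.measurable_floor.comp (by fun_prop)
  have h2 : Measurable fun t : ℝ => ((⌊(t - A) / δ⌋₊ : ℕ) : ℝ) := measurable_from_nat.comp this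
  fun_prop

/-- Every point lies strictly below the end of its cell, so the gap events decrease to the empty set
as the gap width tends to `0`; continuity from above of a finite measure applies. -/
lemma exists_gap_measure_le {Ω κ : Type*} [MeasurableSpace Ω] [Finite κ] (μ : Measure Ω)
    [IsFiniteMeasure μ] {g : κ → Ω → ℝ} (hg : ∀ k, Measurable (g k)) (A : ℝ) {δ : ℝ} (hδ : 0 < δ)
    {η : ENNReal} (hη : η ≠ 0) :
    ∃ γ, 0 < γ ∧ γ < δ ∧ μ {x | ∃ k, cellStart A δ (g k x) + δ - γ < g k x} ≤ η := by
  let γ : ℕ → ℝ := fun n => δ / (n + 2)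
  let B : ℕ → Set Ω := fun n => {x | ∃ k, cellStart A δ (g k x) + δ - γ n < g k x}
  have hγ : Antitone γ := fun m n hmn => by
    simp only [γ]
    gcongr
  have hB : Antitone B := fun m n hmn x ⟨k, hk⟩ => ⟨k, by linarith [hγ hmn]⟩
  have hBm : ∀ n, MeasurableSet (B n) := fun n => by
    simp only [B, Set.ofPred_exists]
    refine MeasurableSet.iUnion fun k => measurableSet_lt ?_ (hg k)
    exact (((measurable_cellStart A δ).comp (hg k)).add_const _).sub_const _
  have hγ0 : Filter.Tendsto γ Filter.atTop (nhds 0) := by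
    refine Filter.Tendsto.div_atTop tendsto_const_nhds ?_
    exact Filter.tendsto_atTop_add_const_right _ _ tendsto_natCast_atTop_atTop
  have hempty : ⋂ n, B n = ∅ := by
    refine Set.eq_empty_of_forall_notMem fun x hx => ?_
    have hev : ∀ᶠ n in Filter.atTop, ∀ k, γ n < cellStart A δ (g k x) + δ - g k x := by
      rw [Filter.eventually_all]
      exact fun k => hγ0.eventually_lt_const (by linarith [lt_cellStart_add (A := A) hδ (g k x)])
    obtain ⟨n, hn⟩ := hev.exists
    obtain ⟨k, hk⟩ := Set.mem_iInter.1 hx n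
    linarith [hn k]
  have ht := tendsto_measure_iInter_atTop (μ := μ) (fun n => (hBm n).nullMeasurableSet) hB
    ⟨0, measure_ne_top _ _⟩
  rw [hempty, measure_empty] at ht
  obtain ⟨n, hn⟩ := (ht.eventually_le_const (pos_iff_ne_zero.2 hη)).exists
  refine ⟨γ n, by simp only [γ]; positivity, ?_, hn⟩
  exact div_lt_self hδ (by linarith [n.cast_nonneg (α := ℝ)])

/-- A positional encoding, zero for equivariant targets, after which the value of a token and the
unordered context determine the output of the target. -/
lemma exists_positional_encoding (i : Fin d) (f : (ι → Fin d → ℝ) → (ι → Fin d → ℝ)) (R : ℝ) :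
    ∃ E : ι → Fin d → ℝ, (TokenEquivariant f → E = 0) ∧
      ∀ v w : ι → Fin d → ℝ, (∀ p l, |v p l - E p l| ≤ R) → (∀ p l, |w p l - E p l| ≤ R) →
        ∀ σ : Equiv.Perm ι, (∀ q, w q = v (σ q)) → ∀ p p', v p = w p' →
          f (w - E) p' = f (v - E) p := by
  classical
  by_cases hf : TokenEquivariant f
  · refine ⟨0, fun _ => rfl, fun v w _ _ σ hσ p p' hp => ?_⟩
    simp only [sub_zero]
    -- `σ` need not send `p'` to `p`, but the tokens there agree, so a swap before `σ` corrects this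
    -- without changing the context.
    let ρ : Equiv.Perm ι := (Equiv.swap p' (σ.symm p)).trans σ
    have hw : w = fun q => v (ρ q) := by
      ext1 q
      simp only [ρ, Equiv.trans_apply]
      rcases eq_or_ne q p' with rfl | h1
      · simp [hp]
      rcases eq_or_ne q (σ.symm p) with rfl | h2
      · rw [Equiv.swap_apply_right, ← hσ, hσ, Equiv.apply_symm_apply, hp]
      · rw [Equiv.swap_apply_of_ne_of_ne h1 h2, hσ]
    rw [hw, hf ρ v]
    simp [ρ]
  -- Intervals of radius `R` around multiples of `2 * |R| + 1` are disjoint, so a token reveals its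
  -- position.
  · refine ⟨fun p _ => (2 * |R| + 1) * (Fintype.equivFin ι p : ℕ), fun h => (hf h).elim,
      fun v w hv hw σ hσ p p' hp => ?_⟩
    have hsep : ∀ q q', v q = w q' → q = q' := by
      intro q q' h
      have h1 := abs_le.1 (hv q i)
      have h2 := abs_le.1 (hw q' i)
      rw [h] at h1
      have hR := le_abs_self R
      set a := Fintype.equivFin ι q
      set b := Fintype.equivFin ι q'
      have hab : a = b := by
        by_contra hne
        rcases lt_or_gt_of_ne hne with hlt | hlt
        · have : ((a : ℕ) : ℝ) + 1 ≤ (b : ℕ) := by exact_mod_cast hlt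
          nlinarith [abs_nonneg R]
        · have : ((b : ℕ) : ℝ) + 1 ≤ (a : ℕ) := by exact_mod_cast hlt
          nlinarith [abs_nonneg R]
      exact (Fintype.equivFin ι).injective hab
    have hvw : w = v := by
      ext1 q
      rw [hσ q, hsep (σ q) q (hσ q).symm]
    rw [hvw, hsep p p' hp]

/-- Post-processing layers that send the attention outputs of finitely many contexts to prescribed
bounded values, and that have bounded range. -/
lemma exists_ffnRealizable_decoder (i : Fin d) {T : Type*} [Finite T] (s : T → ℝ)
    (F : T → Fin d → ℝ) (hF : F.FactorsThrough s) {M : ℝ} (hM : 0 ≤ M)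
    (hFM : ∀ t l, |F t l| ≤ M) :
    ∃ χ, FFNRealizable χ ∧ (∀ x l, |χ x l| ≤ M) ∧ ∀ t, χ (Pi.single i (s t)) = F t := by
  classical
  have := Fintype.ofFinite T
  -- The shift is the lookup table. The clamp below bounds all other outputs too, and fixes the
  -- prescribed ones.
  obtain ⟨φ, hφ, h⟩ := exists_ffnRealizable_shift i (Finset.univ.image s)
    fun t => Function.extend s F 0 t - Pi.single i t
  obtain ⟨ψ, hψ, h1, h2⟩ := exists_coordRealizable_clamp d hM
  refine ⟨_, hψ.map.comp hφ, fun x l => h2 _, fun t => ?_⟩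
  ext l
  rw [h _ (by simp), Pi.single_eq_same, hF.extend_apply, add_sub_cancel, h1 _ (hFM t l)]

/-- `M` precedes `μ` and `η` on purpose: only the gap width, and hence the quantizer, depends on
them. Continuity of the transformer is recorded for the push-forwards needed in the composition. -/
theorem exists_transformer_approx (hd : 0 < d) {α K : ℝ} (hα : 1 ≤ α) (hK : 0 ≤ K)
    {f : (ι → Fin d → ℝ) → (ι → Fin d → ℝ)} (hf : IsLip α K f) (R : ℝ) {ε : ℝ} (hε : 0 < ε) :
    ∃ M, ∀ (μ : Measure (ι → Fin d → ℝ)) [IsFiniteMeasure μ] (η : ENNReal), η ≠ 0 →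
      ∃ τ : OneLayerTransformer ι d 1 4, (TokenEquivariant f → τ.pos = 0) ∧
        Continuous τ.apply ∧ (∀ X p l, |τ.apply X p l| ≤ M) ∧
        μ {X | (∀ p l, |X p l| ≤ R) ∧ ε < entryNorm α (f X - τ.apply X)} ≤ η := by
  classical
  -- Rounding moves entries by at most `δ ≤ 1`, so rounded inputs stay in the box of radius `R + 1`.
  obtain ⟨M, hM, hfM⟩ := hf.exists_bound hK hα (R + 1)
  refine ⟨M, fun μ _ η hη => ?_⟩
  let i : Fin d := ⟨0, hd⟩
  obtain ⟨δ, hδ, hδ1, hδε⟩ : ∃ δ : ℝ, 0 < δ ∧ δ ≤ 1 ∧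
      K * ((Fintype.card (ι × Fin d) : ℝ) ^ (1 / α) * δ) ≤ ε := by
    set c : ℝ := (Fintype.card (ι × Fin d) : ℝ) ^ (1 / α)
    have hc : 0 ≤ c := by positivity
    refine ⟨min 1 (ε / (K * c + 1)), by positivity, min_le_left _ _, ?_⟩
    calc K * (c * min 1 (ε / (K * c + 1))) ≤ K * (c * (ε / (K * c + 1))) := by
          gcongr; exact min_le_right _ _
      _ = ε * ((K * c) / (K * c + 1)) := by ring
      _ ≤ ε * 1 := by
          gcongr
          exact div_le_one_of_le₀ (by linarith) (by positivity)
      _ = ε := mul_one ε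
  obtain ⟨E, hE, hEf⟩ := exists_positional_encoding i f (R + 1)
  obtain ⟨B, hB⟩ : ∃ B, ∀ p l, |E p l| ≤ B := by
    obtain ⟨B, hB⟩ := (Finset.univ.image fun t : ι × Fin d => |E t.1 t.2|).bddAbove
    exact ⟨B, fun p l => hB (by simp)⟩
  set A := -(R + B) with hA
  obtain ⟨N, hN⟩ := exists_nat_gt ((R + B - A) / δ)
  rw [div_lt_iff₀ hδ] at hN
  let V : Finset (Fin d → ℝ) :=
    Fintype.piFinset fun _ => (Finset.range N).image fun j : ℕ => A + j * δ
  obtain ⟨S, L, c, φ, hS, hcS, hcinj, hφ, hφc⟩ := exists_ffnRealizable_encoder i V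
  obtain ⟨x, hx, hxS⟩ := hS.exists_base ι
  -- The rows of the lookup table: a grid context with a position, restricted to contexts on which
  -- `f` is bounded by `M`.
  let T := {t : (Fintype.piFinset fun _ : ι => V) × ι // ∀ p l, |t.1.1 p l - E p l| ≤ R + 1}
  have hVm : ∀ (t : T) q, t.1.1.1 q ∈ V := fun t => Fintype.mem_piFinset.1 t.1.1.2
  obtain ⟨χ, hχ, hχM, hχT⟩ := exists_ffnRealizable_decoder i
    (fun t : T => attnValue x (fun q => c (t.1.1.1 q)) t.1.2)
    (fun t : T => f (t.1.1.1 - E) t.1.2) (by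
      intro t t' h
      obtain ⟨h1, σ, hσ⟩ := hxS _ _ (fun q => hcS _ (hVm t' q)) (fun q => hcS _ (hVm t q)) _ _
        h.symm
      exact hEf _ _ t'.2 t.2 σ (fun q => hcinj (hVm t q) (hVm t' _) (hσ q)) _ _
        (hcinj (hVm t' _) (hVm t _) h1)) hM
    (fun t l => (abs_le_entryNorm hα _ _ _).trans (hfM _ t.2))
  obtain ⟨γ, hγ, hγδ, hγμ⟩ := exists_gap_measure_le μ
    (g := fun (k : ι × Fin d) X => X k.1 k.2 + E k.1 k.2) (fun k => by fun_prop) A hδ hη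
  obtain ⟨ψ, hψ, -, hψc⟩ := exists_coordRealizable_quantizer d A hγ hγδ N
  obtain ⟨τ, hτE, hτc, hτ⟩ := exists_transformer_apply_eq (hφ.comp hψ.map) hχ
    (scalarAttn i (Real.log x)) E
  refine ⟨τ, fun h => hτE.trans (hE h), hτc, fun X p l => by rw [hτ]; exact hχM _ _, ?_⟩
  refine (measure_mono ?_).trans hγμ
  rintro X ⟨hXR, hXε⟩
  by_contra hgood
  simp only [Set.mem_ofPred_eq, not_exists, not_lt, Prod.forall] at hgood
  refine hXε.not_ge ?_
  let v : ι → Fin d → ℝ := fun p l => cellStart A δ (X p l + E p l)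
  have hAX : ∀ p l, A ≤ X p l + E p l ∧ X p l + E p l ≤ R + B := fun p l => by
    have h1 := abs_le.1 (hXR p l)
    have h2 := abs_le.1 (hB p l)
    constructor <;> linarith
  have hle : ∀ p l, v p l ≤ X p l + E p l := fun p l => cellStart_le hδ (hAX p l).1
  have hlt : ∀ p l, X p l + E p l < v p l + δ := fun p l => lt_cellStart_add hδ _
  have hfloor : ∀ p l, ⌊(X p l + E p l - A) / δ⌋₊ < N := fun p l => by
    have hj : A + ⌊(X p l + E p l - A) / δ⌋₊ * δ ≤ X p l + E p l := hle p l
    have : ⌊(X p l + E p l - A) / δ⌋₊ * δ < N * δ := by linarith [(hAX p l).2]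
    exact_mod_cast lt_of_mul_lt_mul_right this hδ.le
  have hψv : ∀ p l, ψ (X p l + E p l) = v p l := fun p l =>
    hψc _ (hfloor p l) _ (hle p l) (hgood p l)
  have hvV : ∀ p, v p ∈ V := fun p => Fintype.mem_piFinset.2 fun l =>
    Finset.mem_image.2 ⟨_, Finset.mem_range.2 (hfloor p l), rfl⟩
  have hdist : ∀ p l, |(X - (v - E)) p l| ≤ δ := fun p l => by
    simp only [Pi.sub_apply]
    rw [abs_le]
    constructor <;> linarith [hle p l, hlt p l]
  have hvE : ∀ p l, |v p l - E p l| ≤ R + 1 := fun p l => by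
    have h1 := abs_le.1 (hdist p l)
    have h2 := abs_le.1 (hXR p l)
    simp only [Pi.sub_apply] at h1
    rw [abs_le]
    constructor <;> linarith
  have hτv : τ.apply X = f (v - E) := by
    rw [hτ]
    ext1 p
    have hpre : ∀ q, φ (fun l => ψ ((X q + E q) l)) i = c (v q) := fun q => by
      rw [← hφc _ (hvV q)]
      congr 2
      ext l
      exact hψv q l
    rw [scalarAttn_apply i hx (v := fun q => c (v q)) hpre]
    exact hχT ⟨(⟨v, Fintype.mem_piFinset.2 hvV⟩, p), hvE⟩
  rw [hτv]
  exact ((hf _ _).trans (mul_le_mul_of_nonneg_left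
    (entryNorm_le_of_abs_le hα hδ.le hdist) hK)).trans hδε

end Transformer

/-! ### Propagation of errors through the stages -/

section Composition

open MeasureTheory

variable {d : ℕ} {h w : ℕ → ℕ}

/-- The path `T (S Z)`, `f (S Z)`, `f (g Z)`, `f (g Y)` has steps of length at most `ε`, `K * ε` and
`K ^ 2 * e`. -/
lemma entryNorm_comp_sub_comp_le {ι κ : Type} [Fintype ι] [Fintype κ] {α K ε e : ℝ} (hα : 1 ≤ α)
    (hK : 0 ≤ K) {f T : (κ → Fin d → ℝ) → (κ → Fin d → ℝ)}
    {g S : (ι → Fin d → ℝ) → (κ → Fin d → ℝ)} (hf : IsLip α K f) (hg : IsLip α K g)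
    {Y Z : ι → Fin d → ℝ} (hT : entryNorm α (f (S Z) - T (S Z)) ≤ ε)
    (hS : entryNorm α (g Z - S Z) ≤ ε) (hYZ : entryNorm α (Z - Y) ≤ e) :
    entryNorm α (T (S Z) - f (g Y)) ≤ ε + K * ε + K ^ 2 * e := by
  have h1 := entryNorm_sub_le hα (T (S Z)) (f (S Z)) (f (g Y))
  have h2 := entryNorm_sub_le hα (f (S Z)) (f (g Z)) (f (g Y))
  have h3 := hf (S Z) (g Z)
  have h4 := hf (g Z) (g Y)
  have h5 := mul_le_mul_of_nonneg_left (hg Z Y) hK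
  have h6 := mul_le_mul_of_nonneg_left hYZ (mul_nonneg hK hK)
  rw [entryNorm_sub_comm] at hT
  rw [entryNorm_sub_comm] at hS
  have h7 := mul_le_mul_of_nonneg_left hS hK
  linarith

/-- The error of `n` composed stages, in units of the error of a single approximation. -/
def stageConst (K : ℝ) : ℕ → ℝ
  | 0 => 0
  | n + 1 => 1 + K + K ^ 2 * stageConst K n

lemma stageConst_nonneg {K : ℝ} (hK : 0 ≤ K) (n : ℕ) : 0 ≤ stageConst K n := by
  induction n with
  | zero => exact le_rfl
  | succ n ih => rw [stageConst]; positivity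

theorem entryNorm_flowAR_sub_word2img_le {s c : ℕ} {α K ε : ℝ} (hα : 1 ≤ α) (hK : 0 ≤ K)
    {f : ∀ i, TokenMap (h (i + 1)) (w (i + 1)) d → TokenMap (h (i + 1)) (w (i + 1)) d}
    {g : ∀ i, TokenMap (h i) (w i) d → TokenMap (h (i + 1)) (w (i + 1)) d}
    {Φ : ∀ i, Matrix (Fin (h (i + 1)) × Fin (w (i + 1))) (Fin (h i) × Fin (w i)) ℝ}
    {τ : ∀ i, OneLayerTransformer (Fin (h (i + 1)) × Fin (w (i + 1))) d s c} (n : ℕ)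
    (hf : ∀ i < n, IsLip α K (f i)) (hg : ∀ i < n, IsLip α K (g i))
    (hΦ : ∀ i < n, ∀ X, entryNorm α (g i X - linearSample (Φ i) X) ≤ ε)
    (hτ : ∀ i < n, ∀ X, entryNorm α (f i X - (τ i).apply X) ≤ ε) (X : TokenMap (h 0) (w 0) d) :
    entryNorm α (flowAR Φ τ n X - word2img f g n X) ≤ stageConst K n * ε := by
  induction n with
  | zero =>
    rw [show flowAR Φ τ 0 X - word2img f g 0 X = 0 from sub_self X, entryNorm_zero hα, stageConst,
      zero_mul]
  | succ n ih =>
    refine (entryNorm_comp_sub_comp_le hα hK (hf n n.lt_succ_self) (hg n n.lt_succ_self)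
      (hτ n n.lt_succ_self _) (hΦ n n.lt_succ_self _)
      (ih (fun i hi => hf i (hi.trans n.lt_succ_self)) (fun i hi => hg i (hi.trans n.lt_succ_self))
        (fun i hi => hΦ i (hi.trans n.lt_succ_self))
        fun i hi => hτ i (hi.trans n.lt_succ_self))).trans_eq ?_
    rw [stageConst]
    ring

lemma isLip_word2img {α K : ℝ} (hK : 0 ≤ K)
    {f : ∀ i, TokenMap (h (i + 1)) (w (i + 1)) d → TokenMap (h (i + 1)) (w (i + 1)) d}
    {g : ∀ i, TokenMap (h i) (w i) d → TokenMap (h (i + 1)) (w (i + 1)) d} (n : ℕ)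
    (hf : ∀ i < n, IsLip α K (f i)) (hg : ∀ i < n, IsLip α K (g i)) :
    IsLip α ((K * K) ^ n) (word2img f g n) := by
  induction n with
  | zero => intro X Y; simp [word2img]
  | succ n ih =>
    rw [pow_succ', mul_assoc]
    have ih := ih (fun i hi => hf i (hi.trans n.lt_succ_self))
      fun i hi => hg i (hi.trans n.lt_succ_self)
    have hgn := IsLip.comp hK (hg n n.lt_succ_self) ih
    have hfn := IsLip.comp hK (hf n n.lt_succ_self) hgn
    exact hfn

/-- This lets a new stage be inserted by `Function.update` without disturbing the earlier ones. -/
lemma flowAR_congr {s c : ℕ}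
    {Φ : ∀ i, Matrix (Fin (h (i + 1)) × Fin (w (i + 1))) (Fin (h i) × Fin (w i)) ℝ}
    {τ τ' : ∀ i, OneLayerTransformer (Fin (h (i + 1)) × Fin (w (i + 1))) d s c} (n : ℕ)
    (hτ : ∀ i < n, τ i = τ' i) : flowAR Φ τ n = flowAR Φ τ' n := by
  induction n with
  | zero => rfl
  | succ n ih =>
    have ih := ih fun i hi => hτ i (hi.trans n.lt_succ_self)
    funext X
    change (τ n).apply (linearSample (Φ n) (flowAR Φ τ n X)) =
      (τ' n).apply (linearSample (Φ n) (flowAR Φ τ' n X))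
    rw [hτ n n.lt_succ_self, ih]

lemma continuous_linearSample {a b a' b' : ℕ} (Φ : Matrix (Fin a' × Fin b') (Fin a × Fin b) ℝ) :
    Continuous (linearSample (d := d) Φ) := by
  unfold linearSample
  fun_prop

lemma exists_linearSample_bound {a b a' b' : ℕ} (Φ : Matrix (Fin a' × Fin b') (Fin a × Fin b) ℝ)
    (R : ℝ) : ∃ R', ∀ X : TokenMap a b d, (∀ p l, |X p l| ≤ R) →
      ∀ p l, |linearSample Φ X p l| ≤ R' := by
  refine ⟨∑ p, ∑ q, |Φ p q| * |R|, fun X hX p l => ?_⟩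
  calc |linearSample Φ X p l| ≤ ∑ q, |Φ p q * X q l| := Finset.abs_sum_le_sum_abs _ _
    _ ≤ ∑ q, |Φ p q| * |R| := by
        refine Finset.sum_le_sum fun q _ => ?_
        rw [abs_mul]
        exact mul_le_mul_of_nonneg_left ((hX q l).trans (le_abs_self R)) (abs_nonneg _)
    _ ≤ _ := Finset.single_le_sum (f := fun p => ∑ q, |Φ p q| * |R|)
        (fun p _ => by positivity) (Finset.mem_univ p)

lemma exists_entry_bound {a b : ℕ} {Ω : Set (TokenMap a b d)} (hΩ : Bornology.IsBounded Ω) :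
    ∃ R, ∀ X ∈ Ω, ∀ p l, |X p l| ≤ R := by
  obtain ⟨R, hR⟩ := hΩ.exists_norm_le
  exact ⟨R, fun X hX p l =>
    ((norm_le_pi_norm (X p) l).trans (norm_le_pi_norm X p)).trans (hR X hX)⟩

/-- The inductive statement carries the bound `R`, chosen before `η`, because the next transformer
needs a box for its inputs that does not depend on the earlier stages' accuracy in measure. -/
theorem exists_flowAR_approx_off_small_set (hd : 0 < d) {α K ε : ℝ} (hα : 1 ≤ α) (hK : 0 ≤ K)
    (hε : 0 < ε)
    {f : ∀ i, TokenMap (h (i + 1)) (w (i + 1)) d → TokenMap (h (i + 1)) (w (i + 1)) d}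
    {g : ∀ i, TokenMap (h i) (w i) d → TokenMap (h (i + 1)) (w (i + 1)) d}
    {Φ : ∀ i, Matrix (Fin (h (i + 1)) × Fin (w (i + 1))) (Fin (h i) × Fin (w i)) ℝ}
    {Ω : Set (TokenMap (h 0) (w 0) d)} (hΩ : Bornology.IsBounded Ω) (n : ℕ)
    (hf : ∀ i < n, IsLip α K (f i)) (hg : ∀ i < n, IsLip α K (g i))
    (hΦ : ∀ i < n, ∀ X, entryNorm α (g i X - linearSample (Φ i) X) ≤ ε) :
    ∃ R, ∀ η : ENNReal, η ≠ 0 →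
      ∃ τ : ∀ i, OneLayerTransformer (Fin (h (i + 1)) × Fin (w (i + 1))) d 1 4,
        (∀ i < n, TokenEquivariant (f i) → (τ i).pos = 0) ∧ Continuous (flowAR Φ τ n) ∧
        (∀ X ∈ Ω, ∀ p l, |flowAR Φ τ n X p l| ≤ R) ∧
        volume (Ω ∩ {X | stageConst K n * ε < entryNorm α (flowAR Φ τ n X - word2img f g n X)})
          ≤ η := by
  induction n with
  | zero =>
    obtain ⟨R, hR⟩ := exists_entry_bound hΩ
    refine ⟨R, fun η _ => ⟨fun _ => ⟨0, [], ⟨0, 0, 0, 0⟩, []⟩, by simp, continuous_id, hR, ?_⟩⟩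
    simp [flowAR, word2img, stageConst, entryNorm_zero hα]
  | succ n ih =>
    obtain ⟨R, hR⟩ := ih (fun i hi => hf i (hi.trans n.lt_succ_self))
      (fun i hi => hg i (hi.trans n.lt_succ_self)) fun i hi => hΦ i (hi.trans n.lt_succ_self)
    obtain ⟨R', hR'⟩ := exists_linearSample_bound (d := d) (Φ n) R
    obtain ⟨M, hM⟩ := exists_transformer_approx hd hα hK (hf n n.lt_succ_self) R' hε
    refine ⟨M, fun η hη => ?_⟩
    have hη2 : η / 2 ≠ 0 := ENNReal.div_ne_zero.2 ⟨hη, by simp⟩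
    obtain ⟨τ, hpos, hcont, hbound, hmeas⟩ := hR (η / 2) hη2
    have hcont' : Continuous fun X => linearSample (Φ n) (flowAR Φ τ n X) :=
      (continuous_linearSample (Φ n)).comp hcont
    have hfin : IsFiniteMeasure (volume.restrict Ω) :=
      isFiniteMeasure_restrict.2 hΩ.measure_lt_top.ne
    -- Under the push-forward, the inputs that the new transformer treats badly pull back to a small
    -- part of `Ω`.
    obtain ⟨τn, hpos', hcontn, hboundn, hmeasn⟩ :=
      hM ((volume.restrict Ω).map fun X => linearSample (Φ n) (flowAR Φ τ n X)) (η / 2) hη2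
    have hflow : flowAR Φ (Function.update τ n τn) n = flowAR Φ τ n :=
      flowAR_congr n fun i hi => Function.update_of_ne hi.ne _ _
    have hstep : flowAR Φ (Function.update τ n τn) (n + 1) =
        fun X => τn.apply (linearSample (Φ n) (flowAR Φ τ n X)) := by
      rw [← hflow]
      funext X
      change (Function.update τ n τn n).apply _ = _
      rw [Function.update_self]
      rfl
    refine ⟨Function.update τ n τn, fun i hi hfi => ?_, ?_, ?_, ?_⟩
    · rcases Nat.lt_succ_iff_lt_or_eq.1 hi with hi | rfl
      · rw [Function.update_of_ne hi.ne]
        exact hpos i hi hfi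
      · rw [Function.update_self]
        exact hpos' hfi
    · rw [hstep]
      exact hcontn.comp hcont'
    · rw [hstep]
      exact fun X _ => hboundn _
    · rw [hstep]
      -- Only inequalities for push-forward and restriction are used, so the exceptional set need
      -- not be known to be measurable.
      have hpre := (Measure.le_map_apply hcont'.measurable.aemeasurable _).trans hmeasn
      have hpre' := (Measure.le_restrict_apply Ω _).trans hpre
      refine le_trans (measure_mono ?_) ((measure_union_le _ _).trans
        ((add_le_add hmeas hpre').trans_eq (ENNReal.add_halves η)))
      rintro X ⟨hXΩ, hX⟩
      by_contra hgood
      rw [Set.mem_union, not_or] at hgood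
      have h1 : entryNorm α (flowAR Φ τ n X - word2img f g n X) ≤ stageConst K n * ε :=
        not_lt.1 fun hlt => hgood.1 ⟨hXΩ, hlt⟩
      have h2 : entryNorm α (f n (linearSample (Φ n) (flowAR Φ τ n X)) -
          τn.apply (linearSample (Φ n) (flowAR Φ τ n X))) ≤ ε :=
        not_lt.1 fun hlt => hgood.2 ⟨⟨hR' _ (hbound X hXΩ), hlt⟩, hXΩ⟩
      refine (lt_irrefl (stageConst K (n + 1) * ε)) (lt_of_lt_of_le hX ?_)
      refine (entryNorm_comp_sub_comp_le hα hK (hf n n.lt_succ_self) (hg n n.lt_succ_self) h2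
        (hΦ n n.lt_succ_self _) h1).trans_eq ?_
      rw [stageConst]
      ring

/-- The integrand is split at the level `a`. The upper bound for the integral of an indicator holds
for arbitrary sets, so `G` may be non-measurable. -/
lemma setLIntegral_rpow_le {E : Type*} [MeasurableSpace E] (μ : Measure E) {Ω : Set E}
    (hΩ : MeasurableSet Ω) {G : E → ℝ} {α a b : ℝ} (hα : 0 ≤ α) (hG : ∀ X ∈ Ω, G X ≤ b) :
    ∫⁻ X in Ω, ENNReal.ofReal (G X) ^ α ∂μ ≤
      ENNReal.ofReal a ^ α * μ Ω + ENNReal.ofReal b ^ α * μ (Ω ∩ {X | a < G X}) := by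
  classical
  calc ∫⁻ X in Ω, ENNReal.ofReal (G X) ^ α ∂μ
      ≤ ∫⁻ X in Ω, (ENNReal.ofReal a ^ α +
          {X | a < G X}.indicator (fun _ => ENNReal.ofReal b ^ α) X) ∂μ := by
        refine setLIntegral_mono' hΩ fun X hX => ?_
        by_cases h : a < G X
        · rw [Set.indicator_of_mem (by exact h)]
          exact le_add_left (by gcongr; exact hG X hX)
        · exact le_add_right (by gcongr; exact not_lt.1 h)
    _ = ENNReal.ofReal a ^ α * μ Ω +
          ∫⁻ X in Ω, {X | a < G X}.indicator (fun _ => ENNReal.ofReal b ^ α) X ∂μ := by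
        rw [lintegral_add_left measurable_const, setLIntegral_const]
    _ ≤ _ := by
        gcongr
        refine (lintegral_indicator_const_le _ _).trans ?_
        rw [Measure.restrict_apply' hΩ, Set.inter_comm]

end Composition

/-! ### The final estimate in function norm -/

theorem corollary6p2 (K : ℝ) (hK : 0 ≤ K) (r : ℕ) :
    ∃ C : ℝ, 0 < C ∧
      ∀ (d : ℕ) (h w : ℕ → ℕ) (α ε : ℝ)
        (f : ∀ i, TokenMap (h (i + 1)) (w (i + 1)) d → TokenMap (h (i + 1)) (w (i + 1)) d)
        (g : ∀ i, TokenMap (h i) (w i) d → TokenMap (h (i + 1)) (w (i + 1)) d)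
        (Φ : ∀ i, Matrix (Fin (h (i + 1)) × Fin (w (i + 1))) (Fin (h i) × Fin (w i)) ℝ),
        0 < d → (∀ i ≤ r, 0 < h i ∧ 0 < w i) → 1 ≤ α → 0 < ε →
        (∀ i < r, IsLip α K (f i)) →
        (∀ i < r, IsLip α K (g i)) →
        (∀ i < r, ∀ X, entryNorm α (g i X - linearSample (Φ i) X) ≤ ε) →
        -- transformers that are uniformly close to the `f i` give a uniformly close FlowAR model
        (∀ (s c : ℕ)
            (τ : ∀ i, OneLayerTransformer (Fin (h (i + 1)) × Fin (w (i + 1))) d s c),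
            (∀ i < r, ∀ X, entryNorm α (f i X - (τ i).apply X) ≤ ε) →
            ∀ X, entryNorm α (flowAR Φ τ r X - word2img f g r X) ≤ C * ε) ∧
        -- and without any such assumption there is a FlowAR model that is close in function norm
        (∀ Ω : Set (TokenMap (h 0) (w 0) d), Bornology.IsBounded Ω → MeasurableSet Ω →
          ∃ τ : ∀ i, OneLayerTransformer (Fin (h (i + 1)) × Fin (w (i + 1))) d 1 4,
            (∀ i < r, TokenEquivariant (f i) → (τ i).pos = 0) ∧
            funNorm α Ω (fun X => flowAR Φ τ r X - word2img f g r X) ≤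
              ENNReal.ofReal (C * ε) * MeasureTheory.volume Ω ^ (1 / α)) := by
  have hC := stageConst_nonneg hK r
  -- The extra `1` pays for the exceptional set, and keeps the constant positive when `r = 0`.
  refine ⟨stageConst K r + 1, by positivity, ?_⟩
  intro d h w α ε f g Φ hd _ hα hε hf hg hΦ
  have hα0 : 0 < α := by positivity
  refine ⟨fun s c τ hτ X => ?_, fun Ω hΩ hΩm => ?_⟩
  · exact (entryNorm_flowAR_sub_word2img_le hα hK r hf hg hΦ hτ X).trans (by nlinarith)
  obtain ⟨R, hR⟩ := exists_flowAR_approx_off_small_set hd hα hK hε hΩ r hf hg hΦ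
  -- A null `Ω` is separate because the tolerance chosen below would be `0`.
  rcases eq_or_ne (MeasureTheory.volume Ω) 0 with hΩ0 | hΩ0
  · obtain ⟨τ, hpos, -⟩ := hR 1 one_ne_zero
    refine ⟨τ, hpos, ?_⟩
    rw [funNorm, MeasureTheory.Measure.restrict_eq_zero.2 hΩ0, MeasureTheory.lintegral_zero_measure,
      ENNReal.zero_rpow_of_pos (by positivity)]
    exact bot_le
  obtain ⟨R₀, hR₀⟩ := exists_entry_bound hΩ
  obtain ⟨M, hM, hMf⟩ := (isLip_word2img hK r hf hg).exists_bound (by positivity) hα R₀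
  set b : ℝ := (Fintype.card ((Fin (h r) × Fin (w r)) × Fin d) : ℝ) ^ (1 / α) * |R| + M + 1 with hb
  have hb0 : 0 < b := by positivity
  have hbα0 : ENNReal.ofReal b ^ α ≠ 0 := by
    simp [ENNReal.rpow_eq_zero_iff, hb0, hα0.not_gt]
  have hbαtop : ENNReal.ofReal b ^ α ≠ ⊤ :=
    ENNReal.rpow_ne_top_of_nonneg hα0.le ENNReal.ofReal_ne_top
  -- With this tolerance the exceptional set, where the error is at most `b`, contributes at most `ε
  -- ^ α * |Ω|` to the integral.
  have hη : ENNReal.ofReal ε ^ α * MeasureTheory.volume Ω / ENNReal.ofReal b ^ α ≠ 0 := by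
    refine ENNReal.div_ne_zero.2 ⟨mul_ne_zero ?_ hΩ0, hbαtop⟩
    simp [ENNReal.rpow_eq_zero_iff, hε, hα0.not_gt]
  obtain ⟨τ, hpos, -, hbound, hmeas⟩ := hR _ hη
  refine ⟨τ, hpos, ?_⟩
  have hG : ∀ X ∈ Ω, entryNorm α (flowAR Φ τ r X - word2img f g r X) ≤ b := by
    intro X hX
    have h1 := entryNorm_add_le hα (flowAR Φ τ r X) (-word2img f g r X)
    have h2 := entryNorm_le_of_abs_le hα (abs_nonneg R)
      fun p l => (hbound X hX p l).trans (le_abs_self R)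
    have h3 := hMf X (hR₀ X hX)
    rw [entryNorm_neg, ← sub_eq_add_neg] at h1
    linarith
  have hint := setLIntegral_rpow_le MeasureTheory.volume hΩm (a := stageConst K r * ε) hα0.le hG
  have hsum : ENNReal.ofReal (stageConst K r * ε) ^ α * MeasureTheory.volume Ω +
      ENNReal.ofReal b ^ α * (ENNReal.ofReal ε ^ α * MeasureTheory.volume Ω / ENNReal.ofReal b ^ α)
      ≤ ENNReal.ofReal ((stageConst K r + 1) * ε) ^ α * MeasureTheory.volume Ω := by
    rw [ENNReal.mul_div_cancel hbα0 hbαtop, ← add_mul, add_mul (stageConst K r), one_mul,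
      ENNReal.ofReal_add (by positivity) hε.le]
    gcongr
    -- Superadditivity of `t ↦ t ^ α` for `α ≥ 1` keeps the constant independent of `α`.
    exact ENNReal.add_rpow_le_rpow_add _ _ hα
  have hfinal := hint.trans ((add_le_add_right (mul_le_mul_right hmeas _) _).trans hsum)
  calc funNorm α Ω (fun X => flowAR Φ τ r X - word2img f g r X)
      ≤ (ENNReal.ofReal ((stageConst K r + 1) * ε) ^ α * MeasureTheory.volume Ω) ^ (1 / α) := by
        unfold funNorm
        gcongr
    _ = _ := by
        rw [ENNReal.mul_rpow_of_nonneg _ _ (by positivity), ← ENNReal.rpow_mul,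
          mul_one_div_cancel hα0.ne', ENNReal.rpow_one]
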